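/- Let $n\ge 0$ and label the squares of the $n\times n$ grid by (row, column) as in a matrix, so that row $1$ is the top row and column $1$ the leftmost column. A \emph{Ferrers board} is a set $B$ of squares of the grid such that $(i,j)\in B$ implies $(k,p)\in B$ whenever $1\le k\le i$ and $j\le p\le n$; let $\mathrm{Area}(B)$ be its number of squares. Rooks are \emph{non-attacking} if no two of them are in the same row or in the same column; below, "above" and "below" a rook mean in its column, and "to the right of" a rook means in its row. Let $q$ be an indeterminate, $[m]=(1-q^m)/(1-q)$ and $[k]!=\prod_{i=1}^k[i]$. For $k\ge 0$ let $$R_k(B)=\sum_{C} q^{\mathrm{inv}(C,B)},$$ where the sum is over all placements $C$ of $k$ non-attacking rooks on squares of $B$, and $\mathrm{inv}(C,B)$ is the number of squares of $B$ that neither contain a rook of $C$ nor are above or to the right of a rook of $C$. The Garsia–Remmel $q$-hit numbers $T_k(B)\in\mathbb{Z}[q]$ are defined by the polynomial identity in $x$ $$\sum_{k=0}^n [k]!\,R_{n-k}(B)\prod_{i=k+1}^n (x-q^i)=\sum_{k=0}^n T_k(B)\,x^k ,$$ with $T_k(B)=0$ for $k>n$. For a placement $C$ of $n$ non-attacking rooks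 on the $n\times n$ grid with exactly $k$ rooks on $B$, let $\mathrm{cross}(C,B)$ be the number of squares of the grid that satisfy at least one of the following conditions: the square contains a rook or is to the right of a rook; the square is on $B$ and above a rook; the square is below a rook which is off $B$. Put $$\mathrm{mat}(C,B)=n(n-k)+\mathrm{Area}(B)-\mathrm{cross}(C,B).$$ \textbf{Theorem.} For every Ferrers board $B$ in the $n\times n$ grid and every integer $k\ge 0$, $$T_k(B)=\sum_{C} q^{\mathrm{mat}(C,B)},$$ where the sum is over all placements $C$ of $n$ non-attacking rooks on the $n\times n$ grid with exactly $k$ rooks on $B$. -/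

import Mathlib

namespace QHit

/-- A square of the `n × n` grid, in (row, column) matrix coordinates: row `0` is the top row and
column `0` is the leftmost column. -/
abbrev Square (n : ℕ) := Fin n × Fin n

/-- A board is a Ferrers board if with each square it contains every square that lies weakly
above and weakly to the right of it. -/
def IsFerrers {n : ℕ} (B : Finset (Square n)) : Prop :=
  ∀ i j k p : Fin n, (i, j) ∈ B → k ≤ i → j ≤ p → (k, p) ∈ B

/-- No two distinct rooks are in the same row, and no two are in the same column. -/
def NonAttacking {n : ℕ} (C : Finset (Square n)) : Prop :=
  ∀ r ∈ C, ∀ s ∈ C, r ≠ s → r.1 ≠ s.1 ∧ r.2 ≠ s.2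

/-- The square `s` is above the rook `r`, in the same column. -/
def Above {n : ℕ} (s r : Square n) : Prop := s.2 = r.2 ∧ s.1 < r.1

/-- The square `s` is below the rook `r`, in the same column. -/
def Below {n : ℕ} (s r : Square n) : Prop := s.2 = r.2 ∧ r.1 < s.1

/-- The square `s` is to the right of the rook `r`, in the same row. -/
def RightOf {n : ℕ} (s r : Square n) : Prop := s.1 = r.1 ∧ r.2 < s.2

open scoped Classical in
/-- Placements of `k` non-attacking rooks on the squares of `B`. -/
noncomputable def placements {n : ℕ} (B : Finset (Square n)) (k : ℕ) :
    Finset (Finset (Square n)) :=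
  (B.powersetCard k).filter NonAttacking

open scoped Classical in
/-- The number of squares of `B` that neither contain a rook of `C` nor are above or to the right
of a rook of `C`. -/
noncomputable def inv {n : ℕ} (C B : Finset (Square n)) : ℕ :=
  (B.filter fun s => ¬ (s ∈ C ∨ ∃ r ∈ C, Above s r ∨ RightOf s r)).card

/-- The `q`-rook polynomial `R_k(B)`; the variable `q` is `Polynomial.X`. -/
noncomputable def rookPoly {n : ℕ} (B : Finset (Square n)) (k : ℕ) : Polynomial ℤ :=
  ∑ C ∈ placements B k, (Polynomial.X : Polynomial ℤ) ^ inv C B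

/-- The `q`-integer `[k] = (1 - q ^ k) / (1 - q) = 1 + q + ⋯ + q ^ (k - 1)`. -/
noncomputable def qInt (k : ℕ) : Polynomial ℤ :=
  ∑ j ∈ Finset.range k, (Polynomial.X : Polynomial ℤ) ^ j

/-- The `q`-factorial `[k]! = [1] [2] ⋯ [k]`. -/
noncomputable def qFact (k : ℕ) : Polynomial ℤ :=
  ∏ i ∈ Finset.Icc 1 k, qInt i

/-- The polynomial `∑_{k=0}^n [k]! R_{n-k}(B) ∏_{i=k+1}^n (x - q ^ i)` in `x` over `ℤ[q]`: here the
outer `Polynomial.X` is `x` and the inner one is `q`. -/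
noncomputable def hitGenPoly {n : ℕ} (B : Finset (Square n)) : Polynomial (Polynomial ℤ) :=
  ∑ k ∈ Finset.range (n + 1),
    Polynomial.C (qFact k * rookPoly B (n - k)) *
      ∏ i ∈ Finset.Icc (k + 1) n,
        (Polynomial.X - Polynomial.C ((Polynomial.X : Polynomial ℤ) ^ i))

/-- The Garsia–Remmel `q`-hit number `T_k(B)`: the coefficient of `x ^ k` in `hitGenPoly B`. -/
noncomputable def hitPoly {n : ℕ} (B : Finset (Square n)) (k : ℕ) : Polynomial ℤ :=
  (hitGenPoly B).coeff k

open scoped Classical in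
/-- Placements of `n` non-attacking rooks on the `n × n` grid with exactly `k` rooks on `B`. -/
noncomputable def hitPlacements {n : ℕ} (B : Finset (Square n)) (k : ℕ) :
    Finset (Finset (Square n)) :=
  (placements (Finset.univ : Finset (Square n)) n).filter fun C => (C ∩ B).card = k

open scoped Classical in
/-- The number of squares of the `n × n` grid that contain a rook or are to the right of a rook, or
are above a rook and on `B`, or are below a rook that is off `B`. -/
noncomputable def cross {n : ℕ} (C B : Finset (Square n)) : ℕ :=
  ((Finset.univ : Finset (Square n)).filter fun s =>
    (s ∈ C ∨ ∃ r ∈ C, RightOf s r) ∨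
    (s ∈ B ∧ ∃ r ∈ C, Above s r) ∨
    (∃ r ∈ C, r ∉ B ∧ Below s r)).card

/-- `mat(C, B) = n (n - k) + Area(B) - cross(C, B)`, an integer, where `k` is the number of rooks of
`C` on `B` and `Area(B)` is the number of squares of `B`. -/
noncomputable def mat {n : ℕ} (C B : Finset (Square n)) : ℤ :=
  (n : ℤ) * ((n : ℤ) - ((C ∩ B).card : ℤ)) + (B.card : ℤ) - (cross C B : ℤ)

end QHit

/-! Put `x = y * q ^ n`. If `C` has `h` rooks on `B` and leaves `u` squares uncrossed, then `mat(C,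
B) = Area(B) + u - n h`, so `x ^ h * q ^ mat = q ^ Area * y ^ h * q ^ u`. The factor `q ^ Area` also
splits off from `R_k = q ^ Area * r_k`. What remains is `H = ∑ c_k r_k`, where `H` weights rooks on
`B` by `y` and uncrossed squares by `q`, and `c_k = [n-k]! ∏_{i=n-k+1}^n (y q ^ n - q ^ i)`.

Both `H` and `r_k` expand along the leftmost column. A rook there deletes its row, the rest is again
a Ferrers board, and only column heights matter; `normRook` and `hitSum` are these recursions, and
`crossSum_rookCross` and `crossSum_hitCross` match them with the placements.

The identity follows by induction on the number of columns (`hitSum_eq_sum_normRook`). Row deletion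
(`sum_normRook_del`) reduces the expansion of `H` to the `r_k` of the remaining columns, at full
height and lowered by one row. Comparison with the expansion of `r_k` leaves a multiple of `[a 0]`
times one sum, which telescopes to zero by the top-row expansion (`sum_hitCoeff_full_row`,
`normRook_full_row`). The field identity then passes to Laurent polynomials in `map_hitGenPoly`. -/

namespace QHit

/-! ### Recursions for q-rook numbers in terms of column heights. -/

section Algebra

variable {K : Type*} [Field K] (q y : K)

/-- The `q`-integer `1 + q + ⋯ + q ^ (n - 1)` at an element `q` of a field. -/
def qNum (n : ℕ) : K := ∑ i ∈ Finset.range n, q ^ i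

@[simp] theorem qNum_zero : qNum q 0 = 0 := by simp [qNum]

theorem qNum_succ (n : ℕ) : qNum q (n + 1) = qNum q n + q ^ n := by
  simp [qNum, Finset.sum_range_succ]

theorem qNum_succ' (n : ℕ) : qNum q (n + 1) = q * qNum q n + 1 := by
  simp [qNum, Finset.sum_range_succ', Finset.mul_sum, pow_succ']

theorem sub_one_mul_qNum (n : ℕ) : (q - 1) * qNum q n = q ^ n - 1 := by
  simpa [qNum] using mul_geom_sum q n

/-- The height of a column of height `x` after deletion of the row with index `i`. -/
def del (i x : ℕ) : ℕ := if i < x then x - 1 else x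

/-- The `q`-rook numbers, divided by `q ^ Area`, of the board whose `m` columns have heights
`a 0 ≤ a 1 ≤ ⋯`, defined by expansion along the leftmost column. -/
def normRook : ℕ → (ℕ → ℕ) → ℕ → K
  | 0, _, 0 => 1
  | 0, _, _ + 1 => 0
  | m + 1, a, 0 => normRook m (fun t => a (t + 1)) 0
  | m + 1, a, k + 1 => normRook m (fun t => a (t + 1)) (k + 1) +
      (q ^ (a 0 + m))⁻¹ * qNum q (a 0) * normRook m (fun t => a (t + 1) - 1) k

/-- The generating function of full rook placements on the `m × m` grid by the number of rooks on
the board with column heights `a 0 ≤ a 1 ≤ ⋯` and the number of uncrossed squares, defined by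
expansion along the leftmost column. -/
def hitSum : ℕ → (ℕ → ℕ) → K
  | 0, _ => 1
  | m + 1, a => ∑ i ∈ Finset.range (m + 1),
      (if i < a 0 then y * q ^ (m - i) else q ^ (i - a 0)) *
        hitSum m (fun t => del i (a (t + 1)))

theorem normRook_zero_right (m : ℕ) (a : ℕ → ℕ) : normRook q m a 0 = 1 := by
  induction m generalizing a with
  | zero => rfl
  | succ m ih => exact ih _

theorem normRook_eq_zero {m k : ℕ} (a : ℕ → ℕ) (h : m < k) : normRook q m a k = 0 := by
  induction m generalizing a k with
  | zero => obtain ⟨k, rfl⟩ := Nat.exists_eq_succ_of_ne_zero h.ne'; rfl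
  | succ m ih =>
    obtain ⟨k, rfl⟩ := Nat.exists_eq_succ_of_ne_zero (Nat.ne_zero_of_lt h)
    simp [normRook, ih _ (show m < k + 1 by omega), ih _ (show m < k by omega)]

variable {q}

theorem mul_normRook_succ (hq : q ≠ 0) (m k : ℕ) (a : ℕ → ℕ) :
    q ^ (a 0 + m) * normRook q (m + 1) a (k + 1) =
      q ^ (a 0 + m) * normRook q m (fun t => a (t + 1)) (k + 1) +
        qNum q (a 0) * normRook q m (fun t => a (t + 1) - 1) k := by
  rw [normRook]
  field_simp

/-- Expansion of the `q`-rook numbers along a top row of full length. -/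
theorem normRook_full_row (hq : q ≠ 0) (m k : ℕ) (a : ℕ → ℕ) (ha : Monotone a) (h0 : 1 ≤ a 0) :
    q ^ (m + k + 1) * normRook q m a (k + 1) =
      q ^ m * normRook q m (fun t => a t - 1) (k + 1) +
        q * (qNum q m - qNum q k) * normRook q m (fun t => a t - 1) k := by
  induction m generalizing a k with
  | zero =>
    cases k with
    | zero => simp [normRook]
    | succ k => simp [normRook]
  | succ m ih =>
    obtain ⟨b, hb⟩ : ∃ b, a 0 = b + 1 := ⟨a 0 - 1, by omega⟩
    have ha' : Monotone fun t => a (t + 1) := fun s t h => ha (by omega)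
    have h1 : 1 ≤ a (0 + 1) := h0.trans (ha (by omega))
    have e1 := mul_normRook_succ hq m k a
    have e2 := mul_normRook_succ hq m k (fun t => a t - 1)
    have e3 := ih k (fun t => a (t + 1)) ha' h1
    simp only [hb, Nat.add_sub_cancel, qNum_succ q b, qNum_succ q m] at e1 e2 ⊢
    set U := normRook q m (fun t => a (t + 1) - 1) with hU
    set V := normRook q m (fun t => a (t + 1)) with hV
    set Z := normRook q m (fun t => a (t + 1) - 1 - 1) with hZ
    have hm : q * qNum q m + 1 = qNum q m + q ^ m :=
      (qNum_succ' q m).symm.trans (qNum_succ q m)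
    refine mul_left_cancel₀ (pow_ne_zero (b + m) hq) ?_
    cases k with
    | zero =>
      have e4 : normRook q (m + 1) (fun t => a t - 1) 0 = 1 := normRook_zero_right _ _ _
      have e5 : U 0 = 1 := normRook_zero_right _ _ _
      have e6 : Z 0 = 1 := normRook_zero_right _ _ _
      rw [e4]
      rw [e5] at e1 e3
      rw [e6] at e2
      simp only [qNum_zero] at e3 ⊢
      linear_combination q ^ (m + 1) * e1 + q ^ (b + m + 1) * e3 - q ^ (m + 1) * e2 +
        q ^ (b + m + 1) * hm
    | succ k =>
      have e4 := mul_normRook_succ hq m k (fun t => a t - 1)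
      simp only [hb, Nat.add_sub_cancel, ← hU, ← hZ] at e4
      have hk := qNum_succ' q k
      have hk1 : q * qNum q (k + 1) + 1 = qNum q (k + 1) + q ^ (k + 1) :=
        (qNum_succ' q (k + 1)).symm.trans (qNum_succ q (k + 1))
      -- The induction hypothesis on the lowered board needs a full top row there, hence `b ≥ 1`;
      -- for `b = 0` the factor `qNum q b` kills both sides.
      have key : qNum q b * (q ^ (m + k + 1) * U (k + 1)) = qNum q b * (q ^ m * Z (k + 1) +
          q * (qNum q m - qNum q k) * Z k) := by
        rcases Nat.eq_zero_or_pos b with rfl | hb0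
        · simp
        · rw [ih k (fun t => a (t + 1) - 1) (fun s t h => Nat.sub_le_sub_right (ha' h) 1)
            (show 1 ≤ a (0 + 1) - 1 by have := ha (Nat.zero_le (0 + 1)); omega)]
      linear_combination q ^ (m + k + 2) * e1 + q ^ (b + m + 1) * e3 - q ^ (m + 1) * e2 -
        q * (qNum q m + q ^ m - qNum q (k + 1)) * e4 + q * key +
        (q * qNum q b * Z k + q ^ (b + m + 1) * U (k + 1)) * hm -
        q ^ (b + m + 1) * U (k + 1) * hk1 + q * qNum q b * Z k * hk

/-- Deletion of one row in all possible ways. -/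
theorem sum_normRook_del (hq : q ≠ 0) (m k N : ℕ) (a : ℕ → ℕ) (ha : Monotone a)
    (hN : ∀ t, a t ≤ N) :
    ∑ i ∈ Finset.range N, q ^ i * normRook q m (fun t => del i (a t)) k =
      (qNum q N - qNum q k) * normRook q m a k := by
  induction m generalizing a k N with
  | zero =>
    cases k with
    | zero => simp [normRook, qNum]
    | succ k => simp [normRook]
  | succ m ih =>
    cases k with
    | zero => simp [normRook_zero_right, qNum]
    | succ k =>
      have ha' : Monotone fun t => a (t + 1) := fun s t h => ha (by omega)
      have e1 := ih (k + 1) N (fun t => a (t + 1)) ha' (fun t => hN _)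
      simp only [normRook, mul_add, Finset.sum_add_distrib]
      rw [e1]
      congr 1
      rcases Nat.eq_zero_or_pos (a 0) with h0 | h0
      · simp [h0, del]
      obtain ⟨b, hb⟩ : ∃ b, a 0 = b + 1 := ⟨a 0 - 1, by omega⟩
      obtain ⟨M, rfl⟩ : ∃ M, N = M + 1 := ⟨N - 1, by have := hN 0; omega⟩
      have hbM : b ≤ M := by have := hN 0; omega
      have hle : ∀ t, b + 1 ≤ a (t + 1) := fun t => hb ▸ ha (Nat.zero_le _)
      -- A rook in the leftmost column uses up one row, so the other columns live on a grid with `M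
      -- = N - 1` rows.
      have e2 := ih k M (fun t => a (t + 1) - 1) (fun s t h => Nat.sub_le_sub_right (ha' h) 1)
        (fun t => by have := hN (t + 1); omega)
      have split1 : ∀ (f : ℕ → K) (c d : ℕ), c ≤ d → ∑ i ∈ Finset.range d, f i =
          ∑ i ∈ Finset.range c, f i + ∑ i ∈ Finset.range (d - c), f (c + i) := by
        intro f c d h
        obtain ⟨e, rfl⟩ := Nat.exists_eq_add_of_le h
        rw [Finset.sum_range_add, Nat.add_sub_cancel_left]
      -- Rows up to `b` meet every column, so deleting one lowers all columns alike. A row `b + 1 +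
      -- i` misses the leftmost column, and deleting it amounts to deleting row `b + i` of the
      -- lowered board; thus the two tails agree up to a factor, and `e2` evaluates them.
      rw [split1 _ (b + 1) (M + 1) (by omega)]
      rw [split1 _ b M hbM] at e2
      have s1 : ∀ i ∈ Finset.range b,
          q ^ i * normRook q m (fun t => del i (a (t + 1) - 1)) k =
          q ^ i * normRook q m (fun t => a (t + 1) - 1 - 1) k := by
        intro i hi
        rw [Finset.mem_range] at hi
        congr 3
        funext t
        have := hle t
        simp only [del]
        rw [if_pos (by omega)]
      have s2 : ∀ i ∈ Finset.range (b + 1),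
          q ^ i * ((q ^ (del i (a 0) + m))⁻¹ * qNum q (del i (a 0)) *
            normRook q m (fun t => del i (a (t + 1)) - 1) k) =
          q ^ i * ((q ^ (b + m))⁻¹ * qNum q b *
            normRook q m (fun t => a (t + 1) - 1 - 1) k) := by
        intro i hi
        rw [Finset.mem_range] at hi
        have h1 : del i (a 0) = b := by simp only [del]; rw [if_pos (by omega)]; omega
        have h2 : (fun t => del i (a (t + 1)) - 1) = fun t => a (t + 1) - 1 - 1 := by
          funext t
          have := hle t
          simp only [del]
          rw [if_pos (by omega)]
        rw [h1, h2]
      have s3 : ∀ i ∈ Finset.range (M + 1 - (b + 1)),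
          q ^ (b + 1 + i) * ((q ^ (del (b + 1 + i) (a 0) + m))⁻¹ *
            qNum q (del (b + 1 + i) (a 0)) *
            normRook q m (fun t => del (b + 1 + i) (a (t + 1)) - 1) k) =
          q * (q ^ (b + 1 + m))⁻¹ * qNum q (b + 1) *
            (q ^ (b + i) * normRook q m (fun t => del (b + i) (a (t + 1) - 1)) k) := by
        intro i hi
        have h1 : del (b + 1 + i) (a 0) = b + 1 := by
          simp only [del]; rw [if_neg (by omega)]; omega
        have h2 : (fun t => del (b + 1 + i) (a (t + 1)) - 1) =
            fun t => del (b + i) (a (t + 1) - 1) := by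
          funext t
          have := hle t
          simp only [del]
          split_ifs <;> omega
        rw [h1, h2]
        ring
      rw [Finset.sum_congr rfl s2, Finset.sum_congr rfl s3, ← Finset.mul_sum, ← Finset.sum_mul,
        Nat.add_sub_add_right]
      rw [Finset.sum_congr rfl s1, ← Finset.sum_mul] at e2
      rw [← eq_sub_iff_add_eq'] at e2
      rw [e2, hb]
      change qNum q (b + 1) * _ + _ * (_ - qNum q b * _) = _
      rw [qNum_succ' q M, qNum_succ' q k]
      field_simp
      ring

/-! ### Hit sums as linear combinations of q-rook numbers. -/

variable (q)

/-- The coefficients that express `hitSum` in terms of `normRook`. -/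
def hitCoeff : ℕ → ℕ → K
  | 0, 0 => 1
  | 0, _ + 1 => 0
  | n + 1, 0 => qNum q (n + 1) * hitCoeff n 0
  | n + 1, k + 1 => q ^ (n + 1) * (y * q ^ k - 1) * hitCoeff n k

/-- The definition moves diagonally; this is the horizontal step. It propagates along diagonals
because `[n+2] - [k+1] = q ([n+1] - [k])`. -/
theorem hitCoeff_succ_left {n k : ℕ} (h : k ≤ n) :
    hitCoeff q y (n + 1) k = (qNum q (n + 1) - qNum q k) * hitCoeff q y n k := by
  induction n generalizing k with
  | zero => obtain rfl : k = 0 := by omega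
            simp [hitCoeff]
  | succ n ih =>
    cases k with
    | zero => simp [hitCoeff]
    | succ k =>
      rw [hitCoeff, ih (by omega), hitCoeff, qNum_succ' q (n + 1), qNum_succ' q k]
      ring

theorem hitCoeff_succ_right {n k : ℕ} (h : k < n) :
    hitCoeff q y n (k + 1) * (qNum q n - qNum q k) =
      q ^ n * (y * q ^ k - 1) * hitCoeff q y n k := by
  obtain ⟨n, rfl⟩ : ∃ m, n = m + 1 := ⟨n - 1, by omega⟩
  rw [hitCoeff_succ_left q y (show k ≤ n by omega), hitCoeff]
  ring

variable {q}

/-- This is the discrepancy between the two leftmost-column expansions. It telescopes: the ratio of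
consecutive coefficients in `hitCoeff_succ_right` fits the top-row expansion `normRook_full_row`. -/
theorem sum_hitCoeff_full_row (hq : q ≠ 0) (n : ℕ) (a : ℕ → ℕ) (ha : Monotone a)
    (h0 : 1 ≤ a 0) :
    ∑ k ∈ Finset.range (n + 1), hitCoeff q y n k *
      ((q ^ (n + 1) - q ^ k) * normRook q n a k +
        (q * (y * q ^ k - 1) - y * q ^ (n + 1) + 1) * normRook q n (fun t => a t - 1) k) = 0 := by
  -- Closed form of the partial sums; the factor `q ^ (n + 1) - q ^ (m + 1)` vanishes at `m = n`.
  have partial_sum : ∀ m ≤ n, q ^ m * ∑ k ∈ Finset.range (m + 1), hitCoeff q y n k *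
      ((q ^ (n + 1) - q ^ k) * normRook q n a k +
        (q * (y * q ^ k - 1) - y * q ^ (n + 1) + 1) * normRook q n (fun t => a t - 1) k) =
      hitCoeff q y n m * (1 - y * q ^ m) * (q ^ (n + 1) - q ^ (m + 1)) *
        normRook q n (fun t => a t - 1) m := by
    intro m hm
    induction m with
    | zero =>
      simp only [zero_add, Finset.sum_range_one, normRook_zero_right]
      ring
    | succ m ih =>
      have e1 := ih (by omega)
      have e2 := hitCoeff_succ_right q y (show m < n by omega)
      have e3 := normRook_full_row hq n m a ha h0
      rw [Finset.sum_range_succ]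
      refine mul_left_cancel₀ (pow_ne_zero n hq) ?_
      linear_combination q ^ (n + 1) * e1 +
        hitCoeff q y n (m + 1) * (q ^ (n + 1) - q ^ (m + 1)) * e3 +
        q * (q ^ (n + 1) - q ^ (m + 1)) * normRook q n (fun t => a t - 1) m * e2
  have := partial_sum n le_rfl
  rw [sub_self, mul_zero, zero_mul] at this
  exact (mul_eq_zero.1 this).resolve_left (pow_ne_zero n hq)

/-- After multiplication by `q ^ a 0`, the weights of the rows off the board become `q ^ i`, as in
`sum_normRook_del`. The rows on the board all give the same lowered board and contribute `[a 0]`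
times it, once with weight `y * q ^ (n + 1)` and once as the correction `-1`. -/
theorem sum_weight_normRook (hq : q ≠ 0) (n k : ℕ) (a : ℕ → ℕ) (ha : Monotone a)
    (hn : ∀ t, a t ≤ n + 1) :
    q ^ a 0 * ∑ i ∈ Finset.range (n + 1),
      (if i < a 0 then y * q ^ (n - i) else q ^ (i - a 0)) *
        normRook q n (fun t => del i (a (t + 1))) k =
      (y * q ^ (n + 1) - 1) * qNum q (a 0) * normRook q n (fun t => a (t + 1) - 1) k +
        (qNum q (n + 1) - qNum q k) * normRook q n (fun t => a (t + 1)) k := by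
  have ha' : Monotone fun t => a (t + 1) := fun s t h => ha (by omega)
  rw [← sum_normRook_del hq n k (n + 1) _ ha' (fun t => hn _)]
  have hA := hn 0
  set A := a 0 with hAdef
  obtain ⟨e, he⟩ := Nat.exists_eq_add_of_le hA
  have low : ∀ i ∈ Finset.range A, normRook q n (fun t => del i (a (t + 1))) k =
      normRook q n (fun t => a (t + 1) - 1) k := by
    intro i hi
    rw [Finset.mem_range] at hi
    congr 1
    funext t
    have : A ≤ a (t + 1) := ha (Nat.zero_le _)
    simp only [del]
    rw [if_pos (by omega)]
  have refl_sum : ∑ i ∈ Finset.range A, q ^ (A - 1 - i) = qNum q A :=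
    Finset.sum_range_reflect (fun i => q ^ i) A
  rw [he, Finset.sum_range_add, Finset.sum_range_add, mul_add]
  have t1 : q ^ A * ∑ i ∈ Finset.range A, (if i < A then y * q ^ (n - i) else q ^ (i - A)) *
      normRook q n (fun t => del i (a (t + 1))) k =
      y * q ^ (A + e) * qNum q A * normRook q n (fun t => a (t + 1) - 1) k := by
    rw [← refl_sum, Finset.mul_sum, Finset.mul_sum, Finset.sum_mul]
    refine Finset.sum_congr rfl fun i hi => ?_
    rw [low i hi]
    rw [Finset.mem_range] at hi
    rw [if_pos hi, show n - i = (A - 1 - i) + e by omega]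
    ring
  have t2 : ∑ i ∈ Finset.range A, q ^ i * normRook q n (fun t => del i (a (t + 1))) k =
      qNum q A * normRook q n (fun t => a (t + 1) - 1) k := by
    rw [qNum, Finset.sum_mul]
    exact Finset.sum_congr rfl fun i hi => by rw [low i hi]
  have t3 : q ^ A * ∑ i ∈ Finset.range e,
      (if A + i < A then y * q ^ (n - (A + i)) else q ^ (A + i - A)) *
        normRook q n (fun t => del (A + i) (a (t + 1))) k =
      ∑ i ∈ Finset.range e, q ^ (A + i) * normRook q n (fun t => del (A + i) (a (t + 1))) k := by
    rw [Finset.mul_sum]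
    refine Finset.sum_congr rfl fun i _ => ?_
    rw [if_neg (by omega), Nat.add_sub_cancel_left]
    ring
  rw [t1, t2, t3]
  ring

theorem hitSum_eq_sum_normRook (hq : q ≠ 0) (n : ℕ) (a : ℕ → ℕ) (ha : Monotone a)
    (hn : ∀ t, a t ≤ n) :
    hitSum q y n a = ∑ k ∈ Finset.range (n + 1), hitCoeff q y n k * normRook q n a k := by
  induction n generalizing a with
  | zero => simp [hitSum, hitCoeff, normRook]
  | succ n ih =>
    have ha' : Monotone fun t => a (t + 1) := fun s t h => ha (by omega)
    have step : ∀ i ∈ Finset.range (n + 1),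
        (if i < a 0 then y * q ^ (n - i) else q ^ (i - a 0)) *
          hitSum q y n (fun t => del i (a (t + 1))) =
        ∑ k ∈ Finset.range (n + 1), hitCoeff q y n k *
          ((if i < a 0 then y * q ^ (n - i) else q ^ (i - a 0)) *
            normRook q n (fun t => del i (a (t + 1))) k) := by
      intro i hi
      rw [Finset.mem_range] at hi
      rw [ih, Finset.mul_sum]
      · exact Finset.sum_congr rfl fun k _ => by ring
      · intro s t h
        have := ha' h
        simp only [del] at this ⊢
        split_ifs <;> omega
      · intro t
        have := hn (t + 1)
        simp only [del]
        split_ifs <;> omega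
    rw [hitSum, Finset.sum_congr rfl step, Finset.sum_comm]
    simp only [← Finset.mul_sum]
    refine mul_left_cancel₀ (pow_ne_zero (a 0) hq) ?_
    have lhs : q ^ a 0 * ∑ k ∈ Finset.range (n + 1), hitCoeff q y n k *
        ∑ i ∈ Finset.range (n + 1), (if i < a 0 then y * q ^ (n - i) else q ^ (i - a 0)) *
            normRook q n (fun t => del i (a (t + 1))) k =
        ∑ k ∈ Finset.range (n + 1), hitCoeff q y n k *
          ((y * q ^ (n + 1) - 1) * qNum q (a 0) * normRook q n (fun t => a (t + 1) - 1) k +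
            (qNum q (n + 1) - qNum q k) * normRook q n (fun t => a (t + 1)) k) := by
      rw [Finset.mul_sum]
      refine Finset.sum_congr rfl fun k _ => ?_
      rw [← sum_weight_normRook y hq n k a ha hn]
      ring
    have rhs : q ^ a 0 * ∑ k ∈ Finset.range (n + 1 + 1),
        hitCoeff q y (n + 1) k * normRook q (n + 1) a k =
        ∑ k ∈ Finset.range (n + 1), hitCoeff q y n k *
          (q ^ a 0 * (qNum q (n + 1) - qNum q k) * normRook q n (fun t => a (t + 1)) k +
            q * (y * q ^ k - 1) * qNum q (a 0) * normRook q n (fun t => a (t + 1) - 1) k) := by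
      have top : ∑ k ∈ Finset.range (n + 1 + 1), hitCoeff q y (n + 1) k *
          normRook q n (fun t => a (t + 1)) k = ∑ k ∈ Finset.range (n + 1),
            hitCoeff q y (n + 1) k * normRook q n (fun t => a (t + 1)) k := by
        rw [Finset.sum_range_succ, normRook_eq_zero q _ (Nat.lt_succ_self n), mul_zero, add_zero]
      have expand : ∑ k ∈ Finset.range (n + 1 + 1),
          hitCoeff q y (n + 1) k * normRook q (n + 1) a k =
          ∑ k ∈ Finset.range (n + 1 + 1), hitCoeff q y (n + 1) k *
            normRook q n (fun t => a (t + 1)) k +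
          ∑ k ∈ Finset.range (n + 1), hitCoeff q y (n + 1) (k + 1) *
            ((q ^ (a 0 + n))⁻¹ * qNum q (a 0) * normRook q n (fun t => a (t + 1) - 1) k) := by
        rw [Finset.sum_range_succ', Finset.sum_range_succ' _ (n + 1)]
        simp only [normRook, mul_add, Finset.sum_add_distrib]
        ring
      rw [expand, top, ← Finset.sum_add_distrib, Finset.mul_sum]
      refine Finset.sum_congr rfl fun k hk => ?_
      rw [hitCoeff_succ_left q y (Nat.lt_succ_iff.1 (Finset.mem_range.1 hk)), hitCoeff]
      field_simp
      ring
    rw [lhs, rhs, ← sub_eq_zero, ← Finset.sum_sub_distrib]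
    -- If the leftmost column is nonempty, the remaining columns have a full top row; otherwise the
    -- factor `[a 0]` is zero.
    have hzero : qNum q (a 0) * ∑ k ∈ Finset.range (n + 1), hitCoeff q y n k *
        ((q ^ (n + 1) - q ^ k) * normRook q n (fun t => a (t + 1)) k +
          (q * (y * q ^ k - 1) - y * q ^ (n + 1) + 1) *
            normRook q n (fun t => a (t + 1) - 1) k) = 0 := by
      rcases Nat.eq_zero_or_pos (a 0) with h0 | h0
      · simp [h0]
      · rw [sum_hitCoeff_full_row y hq n _ ha' (h0.trans_le (ha (Nat.zero_le _))), mul_zero]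
    rw [← neg_eq_zero, ← hzero, ← Finset.sum_neg_distrib, Finset.mul_sum]
    refine Finset.sum_congr rfl fun k _ => ?_
    -- These give `(q ^ a 0 - 1) ([n+1] - [k]) = [a 0] (q ^ (n+1) - q ^ k)`, which exposes the
    -- common factor `[a 0]`.
    have hA := sub_one_mul_qNum q (a 0)
    have h1 := sub_one_mul_qNum q (n + 1)
    have h2 := sub_one_mul_qNum q k
    linear_combination hitCoeff q y n k * normRook q n (fun t => a (t + 1)) k *
      (-(qNum q (n + 1) - qNum q k) * hA + qNum q (a 0) * (h1 - h2))

end Algebra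
end QHit

namespace QHit

/-! ### Decomposition of placements by the leftmost column. -/

section Placements

open scoped Classical in
/-- The squares of `D` in the rows of `S` and the columns from `j` on. -/
noncomputable def region {n : ℕ} (D : Finset (Square n)) (S : Finset (Fin n)) (j : ℕ) :
    Finset (Square n) :=
  D.filter fun s => s.1 ∈ S ∧ j ≤ s.2.val

theorem mem_region {n : ℕ} {D : Finset (Square n)} {S : Finset (Fin n)} {j : ℕ} {s : Square n} :
    s ∈ region D S j ↔ s ∈ D ∧ s.1 ∈ S ∧ j ≤ s.2.val := by
  simp [region]

theorem mem_placements {n : ℕ} {D C : Finset (Square n)} {k : ℕ} :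
    C ∈ placements D k ↔ C ⊆ D ∧ C.card = k ∧ NonAttacking C := by
  simp [placements, Finset.mem_powersetCard, and_assoc]

theorem placements_zero {n : ℕ} (D : Finset (Square n)) : placements D 0 = {∅} := by
  ext C
  rw [mem_placements, Finset.mem_singleton]
  constructor
  · rintro ⟨-, h, -⟩
    exact Finset.card_eq_zero.1 h
  · rintro rfl
    exact ⟨Finset.empty_subset _, rfl, by simp [NonAttacking]⟩

theorem region_eq_empty {n : ℕ} (D : Finset (Square n)) (S : Finset (Fin n)) {j : ℕ}
    (hj : n ≤ j) : region D S j = ∅ := by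
  ext s
  have := s.2.isLt
  simp only [mem_region, Finset.notMem_empty, iff_false]
  omega

theorem region_univ_zero {n : ℕ} (D : Finset (Square n)) : region D Finset.univ 0 = D := by
  ext s
  simp [mem_region]

variable {n : ℕ} {M : Type*} [AddCommMonoid M]

theorem notMem_of_subset_region {D C : Finset (Square n)} {S : Finset (Fin n)} {i j : Fin n}
    (h : C ⊆ region D S (j + 1)) : (i, j) ∉ C := by
  intro hm
  have := (mem_region.1 (h hm)).2.2
  simp at this

theorem insert_mem_placements_iff {D C : Finset (Square n)} {S : Finset (Fin n)} {i j : Fin n}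
    {k : ℕ} (hC : (i, j) ∉ C) :
    insert (i, j) C ∈ placements (region D S j) (k + 1) ↔
      (i ∈ S ∧ (i, j) ∈ D) ∧ C ∈ placements (region D (S.erase i) (j + 1)) k := by
  simp only [mem_placements, Finset.card_insert_of_notMem hC, Nat.add_right_cancel_iff,
    Finset.insert_subset_iff, mem_region]
  simp only [Finset.subset_iff, mem_region]
  constructor
  · rintro ⟨⟨⟨h1, h2, -⟩, h3⟩, h4, h5⟩
    refine ⟨⟨h2, h1⟩, fun s hs => ?_, h4, fun r hr s hs =>
      h5 r (Finset.mem_insert_of_mem hr) s (Finset.mem_insert_of_mem hs)⟩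
    have hne := h5 s (Finset.mem_insert_of_mem hs) (i, j) (Finset.mem_insert_self _ _)
      (fun h => hC (h ▸ hs))
    obtain ⟨g1, g2, g3⟩ := h3 hs
    have : s.2.val ≠ j.val := fun h => hne.2 (Fin.ext h)
    exact ⟨g1, Finset.mem_erase.2 ⟨hne.1, g2⟩, by omega⟩
  · rintro ⟨⟨h1, h2⟩, h3, h4, h5⟩
    refine ⟨⟨⟨h2, h1, le_rfl⟩, fun s hs => ?_⟩, h4, ?_⟩
    · obtain ⟨g1, g2, g3⟩ := h3 hs
      exact ⟨g1, Finset.mem_of_mem_erase g2, by omega⟩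
    · have new : ∀ s ∈ C, s.1 ≠ i ∧ s.2 ≠ j := fun s hs => by
        obtain ⟨-, g2, g3⟩ := h3 hs
        exact ⟨(Finset.mem_erase.1 g2).1, fun h => by rw [h] at g3; omega⟩
      intro r hr s hs hne
      rcases Finset.mem_insert.1 hr with rfl | hr <;> rcases Finset.mem_insert.1 hs with rfl | hs
      · exact absurd rfl hne
      · exact ⟨(new s hs).1.symm, (new s hs).2.symm⟩
      · exact new r hr
      · exact h5 r hr s hs hne

/-- Rook placements are classified by the rook in the leftmost column, if there is one. -/
theorem sum_placements_succ (D : Finset (Square n)) (S : Finset (Fin n)) (j : Fin n) (k : ℕ)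
    (g : Finset (Square n) → M) :
    ∑ C ∈ placements (region D S j) (k + 1), g C =
      ∑ C ∈ placements (region D S (j + 1)) (k + 1), g C +
        ∑ i ∈ S with (i, j) ∈ D, ∑ C ∈ placements (region D (S.erase i) (j + 1)) k,
          g (insert (i, j) C) := by
  classical
  have hdec : placements (region D S j) (k + 1) = placements (region D S (j + 1)) (k + 1) ∪
      (S.filter fun i => (i, j) ∈ D).biUnion fun i =>
        (placements (region D (S.erase i) (j + 1)) k).image (insert (i, j)) := by
    ext C
    simp only [Finset.mem_union, Finset.mem_biUnion, Finset.mem_image, Finset.mem_filter]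
    constructor
    · intro hC
      by_cases h : ∃ i, (i, j) ∈ C
      · obtain ⟨i, hi⟩ := h
        rw [← Finset.insert_erase hi,
          insert_mem_placements_iff (Finset.notMem_erase _ _)] at hC
        exact Or.inr ⟨i, hC.1, _, hC.2, Finset.insert_erase hi⟩
      · left
        rw [mem_placements] at hC ⊢
        refine ⟨fun s hs => ?_, hC.2⟩
        obtain ⟨h1, h2, h3⟩ := mem_region.1 (hC.1 hs)
        have : s.2.val ≠ j.val := fun e => h ⟨s.1, by rwa [← Fin.ext e]⟩
        exact mem_region.2 ⟨h1, h2, by omega⟩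
    · rintro (hC | ⟨i, hi, C, hC, rfl⟩)
      · rw [mem_placements] at hC ⊢
        refine ⟨fun s hs => ?_, hC.2⟩
        obtain ⟨h1, h2, h3⟩ := mem_region.1 (hC.1 hs)
        exact mem_region.2 ⟨h1, h2, by omega⟩
      · exact (insert_mem_placements_iff
          (notMem_of_subset_region (mem_placements.1 hC).1)).2 ⟨hi, hC⟩
  rw [hdec, Finset.sum_union, Finset.sum_biUnion]
  · congr 1
    refine Finset.sum_congr rfl fun i _ => Finset.sum_image fun C hC C' hC' h => ?_
    have h1 := notMem_of_subset_region (i := i) (mem_placements.1 hC).1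
    have h2 := notMem_of_subset_region (i := i) (mem_placements.1 hC').1
    rw [← Finset.erase_insert h1, ← Finset.erase_insert h2]
    exact congrArg (fun E => E.erase (i, j)) h
  · intro i _ i' _ hne
    rw [Function.onFun, Finset.disjoint_left]
    intro C hC hC'
    obtain ⟨E, hE, rfl⟩ := Finset.mem_image.1 hC
    obtain ⟨E', hE', he⟩ := Finset.mem_image.1 hC'
    have : (i', j) ∈ insert (i, j) E := he ▸ Finset.mem_insert_self _ _
    rcases Finset.mem_insert.1 this with h | h
    · exact hne (Prod.ext_iff.1 h).1.symm
    · exact notMem_of_subset_region (mem_placements.1 hE).1 h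
  · rw [Finset.disjoint_left]
    intro C hC hC'
    simp only [Finset.mem_biUnion, Finset.mem_image] at hC'
    obtain ⟨i, -, E, -, rfl⟩ := hC'
    exact notMem_of_subset_region (mem_placements.1 hC).1 (Finset.mem_insert_self _ _)

/-! ### Uncrossed squares for a general crossing rule. -/

open scoped Classical in
/-- The number of squares of `D` that are not crossed by a rook of `C`, where `X s r` says that a
rook on `r` crosses the square `s`. -/
noncomputable def uncrossed (X : Square n → Square n → Prop) (C D : Finset (Square n)) : ℕ :=
  (D.filter fun s => ∀ r ∈ C, ¬ X s r).card

/-- A rook crosses its own square and those to the right of it, and possibly other squares of its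
column, but nothing else. -/
structure IsCrossing (X : Square n → Square n → Prop) : Prop where
  row : ∀ s r, s.1 = r.1 → r.2 ≤ s.2 → X s r
  le : ∀ s r, X s r → r.2 ≤ s.2
  col_or_row : ∀ s r, X s r → s.2 = r.2 ∨ s.1 = r.1

theorem card_filter_region (D : Finset (Square n)) (S : Finset (Fin n)) (j : Fin n)
    (p : Square n → Prop) [DecidablePred p] :
    ((region D S j).filter p).card =
      (S.filter fun i => (i, j) ∈ D ∧ p (i, j)).card + ((region D S (j + 1)).filter p).card := by
  have hinj : Function.Injective fun i : Fin n => (i, j) := fun a b h => (Prod.ext_iff.1 h).1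
  rw [← Finset.card_image_of_injective _ hinj, ← Finset.card_union_of_disjoint]
  · congr 1
    ext ⟨a, b⟩
    simp only [Finset.mem_filter, mem_region, Finset.mem_union, Finset.mem_image, Prod.mk.injEq]
    constructor
    · rintro ⟨⟨h1, h2, h3⟩, h4⟩
      by_cases hb : b = j
      · subst hb
        exact Or.inl ⟨a, ⟨h2, h1, h4⟩, rfl, rfl⟩
      · have : b.val ≠ j.val := fun h => hb (Fin.ext h)
        exact Or.inr ⟨⟨h1, h2, by omega⟩, h4⟩
    · rintro (⟨i, ⟨h1, h2, h3⟩, rfl, rfl⟩ | ⟨⟨h1, h2, h3⟩, h4⟩)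
      · exact ⟨⟨h2, h1, le_rfl⟩, h3⟩
      · exact ⟨⟨h1, h2, by omega⟩, h4⟩
  · rw [Finset.disjoint_left]
    intro s hs hs'
    obtain ⟨i, -, rfl⟩ := Finset.mem_image.1 hs
    have := (mem_region.1 (Finset.mem_filter.1 hs').1).2.2
    simp at this

variable {X : Square n → Square n → Prop}

open scoped Classical in
theorem uncrossed_skip (hX : IsCrossing X) {C D : Finset (Square n)} {S : Finset (Fin n)}
    {j : Fin n} (hC : C ⊆ region D S (j + 1)) :
    uncrossed X C (region D S j) =
      (S.filter fun i => (i, j) ∈ D).card + uncrossed X C (region D S (j + 1)) := by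
  rw [uncrossed, card_filter_region, uncrossed]
  congr 2
  ext i
  simp only [Finset.mem_filter, and_congr_right_iff, and_iff_left_iff_imp]
  intro _ _ r hr h
  have h1 := (mem_region.1 (hC hr)).2.2
  have h2 : r.2.val ≤ j.val := hX.le _ _ h
  omega

-- A rook crosses all of its row to the right and nothing in later columns outside that row. So
-- beyond column `j` it acts exactly as deletion of row `i`.
open scoped Classical in
theorem uncrossed_insert (hX : IsCrossing X) {C D : Finset (Square n)} {S : Finset (Fin n)}
    {i j : Fin n} (hC : C ⊆ region D (S.erase i) (j + 1)) :
    uncrossed X (insert (i, j) C) (region D S j) =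
      (S.filter fun r => (r, j) ∈ D ∧ ¬ X (r, j) (i, j)).card +
        uncrossed X C (region D (S.erase i) (j + 1)) := by
  rw [uncrossed, card_filter_region, uncrossed]
  congr 2
  · ext r
    simp only [Finset.mem_filter, and_congr_right_iff, Finset.forall_mem_insert,
      and_iff_left_iff_imp]
    intro _ _ _ s hs h
    have h1 := (mem_region.1 (hC hs)).2.2
    have h2 : s.2.val ≤ j.val := hX.le _ _ h
    omega
  · ext s
    simp only [Finset.mem_filter, Finset.forall_mem_insert, mem_region, Finset.mem_erase]
    constructor
    · rintro ⟨⟨h1, h2, h3⟩, h4, h5⟩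
      exact ⟨⟨h1, ⟨fun h => h4 (hX.row _ _ h (Fin.le_def.2 (by simp only; omega))), h2⟩, h3⟩, h5⟩
    · rintro ⟨⟨h1, ⟨h2, h3⟩, h4⟩, h5⟩
      refine ⟨⟨h1, h3, h4⟩, fun h => ?_, h5⟩
      rcases hX.col_or_row _ _ h with e | e
      · have : s.2.val = j.val := congrArg Fin.val e
        omega
      · exact h2 e

variable {K : Type*} [Field K]

/-- The generating function of the placements of `k` rooks on `region D S j` by the weights `w` of
the rooks and the number of uncrossed squares. -/
noncomputable def crossSum (q : K) (w : Square n → K) (X : Square n → Square n → Prop)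
    (D : Finset (Square n)) (k : ℕ) (S : Finset (Fin n)) (j : ℕ) : K :=
  ∑ C ∈ placements (region D S j) k, (∏ r ∈ C, w r) * q ^ uncrossed X C (region D S j)

open scoped Classical in
theorem crossSum_zero (q : K) (w : Square n → K) (D : Finset (Square n)) (S : Finset (Fin n))
    (j : ℕ) : crossSum q w X D 0 S j = q ^ (region D S j).card := by
  simp [crossSum, placements_zero, uncrossed]

/-- Too few columns are left for the rooks. The condition `k ≠ 0` excludes the empty placement,
which still counts when `j > n`. -/
theorem crossSum_eq_zero (q : K) (w : Square n → K) (D : Finset (Square n)) (S : Finset (Fin n))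
    {j k : ℕ} (h : n < j + k) (hk : k ≠ 0) : crossSum q w X D k S j = 0 := by
  classical
  rw [crossSum, Finset.sum_eq_zero]
  intro C hC
  exfalso
  obtain ⟨h1, h2, h3⟩ := mem_placements.1 hC
  have hinj : Set.InjOn (fun s : Square n => s.2.val) C := fun s hs t ht e => by
    by_contra hne
    exact (h3 s hs t ht hne).2 (Fin.ext e)
  have hsub : C.image (fun s : Square n => s.2.val) ⊆ Finset.Ico j n := by
    intro c hc
    obtain ⟨s, hs, rfl⟩ := Finset.mem_image.1 hc
    exact Finset.mem_Ico.2 ⟨(mem_region.1 (h1 hs)).2.2, s.2.isLt⟩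
  have := Finset.card_le_card hsub
  rw [Finset.card_image_of_injOn hinj, Nat.card_Ico] at this
  omega

open scoped Classical in
/-- Expansion along the leftmost column. -/
theorem crossSum_succ (hX : IsCrossing X) (q : K) (w : Square n → K) (D : Finset (Square n))
    (k : ℕ) (S : Finset (Fin n)) (j : Fin n) :
    crossSum q w X D (k + 1) S j =
      q ^ (S.filter fun i => (i, j) ∈ D).card * crossSum q w X D (k + 1) S (j + 1) +
        ∑ i ∈ S with (i, j) ∈ D,
          w (i, j) * q ^ (S.filter fun r => (r, j) ∈ D ∧ ¬ X (r, j) (i, j)).card *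
            crossSum q w X D k (S.erase i) (j + 1) := by
  rw [crossSum, sum_placements_succ]
  congr 1
  · rw [crossSum, Finset.mul_sum]
    refine Finset.sum_congr rfl fun C hC => ?_
    rw [uncrossed_skip hX (mem_placements.1 hC).1, pow_add]
    ring
  · refine Finset.sum_congr (by congr) fun i _ => ?_
    rw [crossSum, Finset.mul_sum]
    refine Finset.sum_congr rfl fun C hC => ?_
    have hC' := (mem_placements.1 hC).1
    rw [uncrossed_insert hX hC', pow_add, Finset.prod_insert (notMem_of_subset_region hC')]
    ring

end Placements

end QHit

namespace QHit

/-! ### Column heights of a Ferrers board after row deletions. -/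

section Heights

variable {n : ℕ}

open scoped Classical in
/-- The number of squares of `B` in column `t` and the rows of `S`; columns outside the grid count
as filled. -/
noncomputable def colCount (B : Finset (Square n)) (S : Finset (Fin n)) (t : ℕ) : ℕ :=
  (S.filter fun i => ∀ ht : t < n, (i, (⟨t, ht⟩ : Fin n)) ∈ B).card

/-- The number of elements of `S` below `i`. -/
def rank (S : Finset (Fin n)) (i : Fin n) : ℕ := (S.filter fun r => r < i).card

theorem colCount_val (B : Finset (Square n)) (S : Finset (Fin n)) (j : Fin n) :
    colCount B S j = (S.filter fun i => (i, j) ∈ B).card := by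
  rw [colCount]
  congr 1
  ext i
  simp

/-- Counting columns outside the grid as filled extends monotonicity to all of `ℕ`, as the algebraic
lemmas require. -/
theorem colCount_mono {B : Finset (Square n)} (hB : IsFerrers B) (S : Finset (Fin n)) :
    Monotone (colCount B S) := by
  intro s t h
  refine Finset.card_le_card fun i hi => ?_
  simp only [Finset.mem_filter] at hi ⊢
  exact ⟨hi.1, fun ht => hB i ⟨s, by omega⟩ i ⟨t, ht⟩ (hi.2 _) le_rfl (Fin.mk_le_mk.2 h)⟩

theorem colCount_le_card (B : Finset (Square n)) (S : Finset (Fin n)) (t : ℕ) :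
    colCount B S t ≤ S.card :=
  Finset.card_filter_le _ _

/-- In each column the board occupies an initial segment of `S`. With `colCount_le_rank`, membership
in `B` is therefore a comparison of rank with height. -/
theorem rank_lt_colCount {B : Finset (Square n)} (hB : IsFerrers B) {S : Finset (Fin n)}
    {i : Fin n} (hi : i ∈ S) {t : ℕ} (h : ∀ ht : t < n, (i, (⟨t, ht⟩ : Fin n)) ∈ B) :
    rank S i < colCount B S t := by
  classical
  refine Finset.card_lt_card (Finset.ssubset_iff_of_subset (fun r hr => ?_) |>.2 ⟨i, ?_, ?_⟩)
  · rw [Finset.mem_filter] at hr ⊢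
    exact ⟨hr.1, fun ht => hB i _ r _ (h ht) hr.2.le le_rfl⟩
  · exact Finset.mem_filter.2 ⟨hi, h⟩
  · simp

theorem colCount_le_rank {B : Finset (Square n)} (hB : IsFerrers B) (S : Finset (Fin n))
    {i : Fin n} {t : ℕ} (h : ¬ ∀ ht : t < n, (i, (⟨t, ht⟩ : Fin n)) ∈ B) :
    colCount B S t ≤ rank S i := by
  refine Finset.card_le_card fun r hr => ?_
  rw [Finset.mem_filter] at hr ⊢
  refine ⟨hr.1, lt_of_not_ge fun hle => h fun ht => ?_⟩
  exact hB r _ i _ (hr.2 ht) hle le_rfl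

theorem colCount_erase {B : Finset (Square n)} (hB : IsFerrers B) {S : Finset (Fin n)}
    {i : Fin n} (hi : i ∈ S) (t : ℕ) :
    colCount B (S.erase i) t = del (rank S i) (colCount B S t) := by
  classical
  by_cases h : ∀ ht : t < n, (i, (⟨t, ht⟩ : Fin n)) ∈ B
  · rw [del, if_pos (rank_lt_colCount hB hi h), colCount, Finset.filter_erase,
      Finset.card_erase_of_mem (Finset.mem_filter.2 ⟨hi, h⟩), colCount]
  · rw [del, if_neg (not_lt.2 (colCount_le_rank hB S h)), colCount, Finset.filter_erase,
      Finset.erase_eq_of_notMem (fun hm => h (Finset.mem_filter.1 hm).2), colCount]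

theorem sum_rank {M : Type*} [AddCommMonoid M] (S : Finset (Fin n)) (φ : ℕ → M) :
    ∑ i ∈ S, φ (rank S i) = ∑ i ∈ Finset.range S.card, φ i := by
  classical
  induction S using Finset.induction_on_max with
  | empty => simp
  | insert a S ha ih =>
    have hn : a ∉ S := fun h => lt_irrefl _ (ha a h)
    rw [Finset.sum_insert hn, Finset.card_insert_of_notMem hn, Finset.sum_range_succ, add_comm,
      ← ih]
    congr 1
    · refine Finset.sum_congr rfl fun i hi => ?_
      rw [rank, Finset.filter_insert, if_neg (ha i hi).not_gt, rank]
    · rw [rank, Finset.filter_insert, if_neg (lt_irrefl a), Finset.filter_true_of_mem ha]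

theorem card_filter_gt {S : Finset (Fin n)} {i : Fin n} (hi : i ∈ S) :
    (S.filter fun r => i < r).card = S.card - 1 - rank S i := by
  classical
  have h1 := Finset.card_filter_add_card_filter_not (s := S) (fun r => r < i)
  have h2 : S.filter (fun r => ¬ r < i) = insert i (S.filter fun r => i < r) := by
    ext r
    simp only [Finset.mem_filter, Finset.mem_insert, not_lt, le_iff_lt_or_eq]
    constructor
    · rintro ⟨h, h' | rfl⟩
      · exact Or.inr ⟨h, h'⟩
      · exact Or.inl rfl
    · rintro (rfl | ⟨h, h'⟩)
      · exact ⟨hi, Or.inr rfl⟩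
      · exact ⟨h, Or.inl h'⟩
  rw [h2, Finset.card_insert_of_notMem (by simp)] at h1
  rw [rank]
  omega

theorem card_region (D : Finset (Square n)) (S : Finset (Fin n)) (m j : ℕ) (h : j + m = n) :
    (region D S j).card = ∑ t ∈ Finset.range m, colCount D S (j + t) := by
  induction m generalizing j with
  | zero => rw [region_eq_empty D S (by omega)]; simp
  | succ m ih =>
    have e := card_filter_region D S ⟨j, by omega⟩ (fun _ => True)
    simp only [Finset.filter_true, and_true] at e
    rw [e, ← colCount_val, ih (j + 1) (by omega), Finset.sum_range_succ', add_comm]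
    simp only [add_zero, add_assoc, add_comm 1]

/-! ### The crossing rules of `inv` and `cross`, matched with the recursions. -/

variable {K : Type*} [Field K] {q : K}

theorem sum_pow_card_gt (S : Finset (Fin n)) :
    ∑ i ∈ S, q ^ (S.filter fun r => i < r).card = qNum q S.card := by
  rw [Finset.sum_congr rfl fun i hi => by rw [card_filter_gt hi],
    sum_rank S (fun t => q ^ (S.card - 1 - t))]
  exact Finset.sum_range_reflect (fun i => q ^ i) S.card

/-- The squares crossed by a rook in the statistic `inv`. -/
def RookCross (s r : Square n) : Prop := s = r ∨ Above s r ∨ RightOf s r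

theorem isCrossing_rookCross : IsCrossing (RookCross (n := n)) where
  row s r h h' := by
    rcases h'.eq_or_lt with e | e
    · exact Or.inl (Prod.ext h e.symm)
    · exact Or.inr (Or.inr ⟨h, e⟩)
  le s r h := by
    rcases h with rfl | h | h
    · exact le_rfl
    · exact h.1.ge
    · exact h.2.le
  col_or_row s r h := by
    rcases h with rfl | h | h
    · exact Or.inl rfl
    · exact Or.inl h.1
    · exact Or.inr h.1

/-- The squares crossed by a rook in the statistic `cross`. -/
def HitCross (B : Finset (Square n)) (s r : Square n) : Prop :=
  s = r ∨ RightOf s r ∨ (s ∈ B ∧ Above s r) ∨ (r ∉ B ∧ Below s r)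

theorem isCrossing_hitCross (B : Finset (Square n)) : IsCrossing (HitCross B) where
  row s r h h' := by
    rcases h'.eq_or_lt with e | e
    · exact Or.inl (Prod.ext h e.symm)
    · exact Or.inr (Or.inl ⟨h, e⟩)
  le s r h := by
    rcases h with rfl | h | h | h
    · exact le_rfl
    · exact h.2.le
    · exact h.2.1.ge
    · exact h.2.1.ge
  col_or_row s r h := by
    rcases h with rfl | h | h | h
    · exact Or.inl rfl
    · exact Or.inr h.1
    · exact Or.inl h.2.1
    · exact Or.inl h.2.1

-- A rook in the leftmost column leaves uncrossed there exactly the board squares below it, which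
-- sum to `[a 0]`. By the Ferrers shape its row meets every later column, so each of them loses one
-- square.
open scoped Classical in
theorem crossSum_rookCross (hq : q ≠ 0) {B : Finset (Square n)} (hB : IsFerrers B) (m j k : ℕ)
    (h : j + m = n) (S : Finset (Fin n)) :
    crossSum q (fun _ => 1) RookCross B k S j =
      q ^ (∑ t ∈ Finset.range m, colCount B S (j + t)) *
        normRook q m (fun t => colCount B S (j + t)) k := by
  induction m generalizing j k S with
  | zero =>
    cases k with
    | zero => rw [crossSum_zero, region_eq_empty B S (by omega)]; simp [normRook]
    | succ k => rw [crossSum_eq_zero _ _ _ _ (by omega) (by omega)]; simp [normRook]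
  | succ m ih =>
    cases k with
    | zero => rw [crossSum_zero, normRook_zero_right, card_region B S (m + 1) j h, mul_one]
    | succ k =>
      have hj : j < n := by omega
      have e := crossSum_succ isCrossing_rookCross q (fun _ => 1) B k S ⟨j, hj⟩
      simp only at e
      have shift : ∀ (S : Finset (Fin n)) (t : ℕ),
          colCount B S (j + (t + 1)) = colCount B S (j + 1 + t) := fun S t => by
        rw [add_assoc, add_comm 1 t]
      set T := S.filter fun i => (i, (⟨j, hj⟩ : Fin n)) ∈ B with hT
      have hTc : colCount B S j = T.card := colCount_val B S ⟨j, hj⟩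
      have hterm : ∀ i ∈ T, 1 * q ^ (S.filter fun r => (r, (⟨j, hj⟩ : Fin n)) ∈ B ∧
            ¬ RookCross (r, (⟨j, hj⟩ : Fin n)) (i, ⟨j, hj⟩)).card *
          crossSum q (fun _ => 1) RookCross B k (S.erase i) (j + 1) =
          q ^ (T.filter fun r => i < r).card *
            (q ^ (∑ t ∈ Finset.range m, (colCount B S (j + 1 + t) - 1)) *
              normRook q m (fun t => colCount B S (j + 1 + t) - 1) k) := by
        intro i hi
        obtain ⟨hiS, hiB⟩ := Finset.mem_filter.1 hi
        have hcol : ∀ t, colCount B (S.erase i) (j + 1 + t) = colCount B S (j + 1 + t) - 1 := by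
          intro t
          rw [colCount_erase hB hiS, del, if_pos]
          exact rank_lt_colCount hB hiS fun ht =>
            hB i ⟨j, hj⟩ i _ hiB le_rfl (Fin.mk_le_mk.2 (by omega))
        rw [ih (j + 1) k (by omega), one_mul]
        simp only [hcol]
        congr 2
        rw [hT, Finset.filter_filter]
        congr 1
        ext r
        simp only [Finset.mem_filter, RookCross, Above, RightOf, Prod.mk.injEq, and_true,
          true_and, lt_irrefl, and_false, or_false, not_or, not_lt, and_congr_right_iff]
        intro _ _
        rw [lt_iff_le_and_ne, and_comm, ne_comm]
      rw [e, ← hTc, ih (j + 1) (k + 1) (by omega) S, Finset.sum_congr rfl hterm,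
        ← Finset.sum_mul, sum_pow_card_gt, ← hTc, normRook, Finset.sum_range_succ']
      simp only [shift, add_zero]
      rcases Nat.eq_zero_or_pos (colCount B S j) with h0 | h0
      · simp [h0]
      -- All later columns are nonempty, so the truncated subtraction is exact and the area drops by
      -- `m`; this accounts for the `m` in the exponent of `normRook`.
      · have hA : ∑ t ∈ Finset.range m, colCount B S (j + 1 + t) =
            ∑ t ∈ Finset.range m, (colCount B S (j + 1 + t) - 1) + m := by
          have : ∀ t ∈ Finset.range m, colCount B S (j + 1 + t) =
              (colCount B S (j + 1 + t) - 1) + 1 := fun t _ => by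
            have := colCount_mono hB S (show j ≤ j + 1 + t by omega)
            omega
          conv_lhs => rw [Finset.sum_congr rfl this, Finset.sum_add_distrib]
          simp
        rw [hA]
        field_simp
        ring

open scoped Classical in
theorem crossSum_hitCross (y : K) {B : Finset (Square n)} (hB : IsFerrers B) (m j : ℕ)
    (h : j + m = n) (S : Finset (Fin n)) (hS : S.card = m) :
    crossSum q (fun r => if r ∈ B then y else 1) (HitCross B) Finset.univ m S j =
      hitSum q y m (fun t => colCount B S (j + t)) := by
  induction m generalizing j S with
  | zero => rw [crossSum_zero, region_eq_empty _ _ (by omega)]; simp [hitSum]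
  | succ m ih =>
    have hj : j < n := by omega
    have e := crossSum_succ (isCrossing_hitCross B) q (fun r => if r ∈ B then y else 1)
      Finset.univ m S ⟨j, hj⟩
    simp only at e
    -- Leaving column `j` empty would force `m + 1` rooks into `m` columns.
    rw [e, crossSum_eq_zero _ _ _ _ (by omega) (by omega), mul_zero, zero_add, hitSum, ← hS,
      ← sum_rank S]
    simp only [Finset.mem_univ, Finset.filter_true, true_and]
    refine Finset.sum_congr rfl fun i hi => ?_
    have hcol : (fun t => colCount B (S.erase i) (j + 1 + t)) =
        fun t => del (rank S i) (colCount B S (j + (t + 1))) := by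
      funext t
      rw [colCount_erase hB hi, add_assoc, add_comm 1 t]
    rw [ih (j + 1) (by omega) _ (by rw [Finset.card_erase_of_mem hi]; omega), hcol]
    congr 1
    rw [add_zero]
    have hval := colCount_val B S ⟨j, hj⟩
    simp only at hval
    -- For a rook on `B`, everything above it is on `B` and crossed, so the squares below it remain.
    -- For a rook off `B`, the squares above it and off `B` remain.
    by_cases hiB : (i, (⟨j, hj⟩ : Fin n)) ∈ B
    · rw [if_pos hiB, if_pos (rank_lt_colCount hB hi fun _ => hiB)]
      have := card_filter_gt hi
      rw [hS, Nat.add_sub_cancel] at this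
      rw [← this]
      congr 3
      ext r
      simp only [Finset.mem_filter, HitCross, Above, Below, RightOf, Prod.mk.injEq, and_true,
        true_and, lt_irrefl, and_false, false_or, hiB, not_true, false_and, or_false, not_or,
        and_congr_right_iff]
      intro _
      constructor
      · rintro ⟨h1, h2⟩
        by_contra h3
        have hlt : r < i := lt_of_le_of_ne (not_lt.1 h3) h1
        exact h2 ⟨hB i _ r _ hiB hlt.le le_rfl, hlt⟩
      · exact fun h1 => ⟨h1.ne', fun h2 => lt_asymm h1 h2.2⟩
    · have hle : colCount B S j ≤ rank S i := colCount_le_rank hB S fun h => hiB (h hj)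
      rw [if_neg hiB, if_neg (not_lt.2 hle), one_mul]
      congr 1
      have hsub : S.filter (fun r => (r, (⟨j, hj⟩ : Fin n)) ∈ B) ⊆ S.filter fun r => r < i := by
        intro r hr
        rw [Finset.mem_filter] at hr ⊢
        exact ⟨hr.1, lt_of_not_ge fun hle => hiB (hB r _ i _ hr.2 hle le_rfl)⟩
      rw [hval, rank, ← Finset.card_sdiff_of_subset hsub]
      congr 1
      ext r
      simp only [Finset.mem_filter, Finset.mem_sdiff, HitCross, Above, Below, RightOf,
        Prod.mk.injEq, and_true, true_and, lt_irrefl, and_false, false_or, hiB, not_false_eq_true,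
        not_or, not_and, not_lt]
      constructor
      · rintro ⟨h1, h2, h3, h4⟩
        have hlt : r < i := lt_of_le_of_ne h4 h2
        exact ⟨⟨h1, hlt⟩, fun _ hr => absurd hlt (not_lt.2 (h3 hr))⟩
      · rintro ⟨⟨h1, h2⟩, h3⟩
        exact ⟨h1, h2.ne, fun hr => absurd hr (h3 h1), h2.le⟩

end Heights

end QHit

namespace QHit

/-! ### From the recursions to the q-hit numbers. -/

section Final

variable {n : ℕ} {K : Type*} [Field K] {q : K}

theorem inv_eq_uncrossed (C B : Finset (Square n)) : inv C B = uncrossed RookCross C B := by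
  classical
  rw [inv, uncrossed]
  congr 1
  ext s
  simp only [Finset.mem_filter, RookCross, and_congr_right_iff, not_or, not_exists, not_and]
  intro _
  constructor
  · rintro ⟨h1, h2⟩ r hr
    exact ⟨fun h => h1 (h ▸ hr), h2 r hr⟩
  · intro h
    exact ⟨fun hs => (h s hs).1 rfl, fun r hr => (h r hr).2⟩

theorem cross_add_uncrossed (C B : Finset (Square n)) :
    cross C B + uncrossed (HitCross B) C Finset.univ = n * n := by
  classical
  have h : cross C B =
      (Finset.univ.filter fun s : Square n => ¬ ∀ r ∈ C, ¬ HitCross B s r).card := by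
    rw [cross]
    congr 1
    ext s
    simp only [Finset.mem_filter, Finset.mem_univ, true_and, HitCross, not_forall, not_not]
    constructor
    · rintro ((h | ⟨r, hr, h⟩) | ⟨h, r, hr, h'⟩ | ⟨r, hr, h⟩)
      · exact ⟨s, h, Or.inl rfl⟩
      · exact ⟨r, hr, Or.inr (Or.inl h)⟩
      · exact ⟨r, hr, Or.inr (Or.inr (Or.inl ⟨h, h'⟩))⟩
      · exact ⟨r, hr, Or.inr (Or.inr (Or.inr h))⟩
    · rintro ⟨r, hr, rfl | h | h | h⟩
      · exact Or.inl (Or.inl hr)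
      · exact Or.inl (Or.inr ⟨r, hr, h⟩)
      · exact Or.inr (Or.inl ⟨h.1, r, hr, h.2⟩)
      · exact Or.inr (Or.inr ⟨r, hr, h⟩)
  rw [h, uncrossed, add_comm]
  have := Finset.card_filter_add_card_filter_not (s := (Finset.univ : Finset (Square n)))
    (fun s => ∀ r ∈ C, ¬ HitCross B s r)
  simpa using this

/-- Since `y q ^ (m+1) - q ^ (i+1) = q (y q ^ m - q ^ i)`, a diagonal step shifts the product and
adds one factor at its lower end. -/
theorem hitCoeff_eq_prod (y : K) {m k : ℕ} (h : k ≤ m) :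
    hitCoeff q y m k = (∏ i ∈ Finset.Icc 1 (m - k), qNum q i) *
      ∏ i ∈ Finset.Icc (m - k + 1) m, (y * q ^ m - q ^ i) := by
  induction m generalizing k with
  | zero => obtain rfl : k = 0 := by omega
            simp [hitCoeff]
  | succ m ih =>
    cases k with
    | zero =>
      rw [hitCoeff, ih (Nat.zero_le _)]
      simp [Finset.prod_Icc_succ_top, mul_comm]
    | succ k =>
      have hk : k ≤ m := by omega
      rw [hitCoeff, ih hk, Nat.add_sub_add_right]
      obtain ⟨e, rfl⟩ := Nat.exists_eq_add_of_le' hk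
      rw [Nat.add_sub_cancel]
      have hshift : ∏ i ∈ Finset.Icc (e + 1) (e + k + 1), (y * q ^ (e + k + 1) - q ^ i) =
          ∏ i ∈ Finset.Icc e (e + k), (q * (y * q ^ (e + k) - q ^ i)) := by
        rw [← Finset.map_add_right_Icc, Finset.prod_map]
        refine Finset.prod_congr rfl fun i _ => ?_
        simp only [addRightEmbedding_apply]
        ring
      rw [hshift, Finset.prod_mul_distrib, Finset.prod_const, Nat.card_Icc,
        ← Finset.mul_prod_Ioc_eq_prod_Icc (show e ≤ e + k by omega)]
      have : Finset.Ioc e (e + k) = Finset.Icc (e + 1) (e + k) := by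
        ext i; simp
      rw [this, show e + k + 1 - e = k + 1 by omega]
      ring

theorem sum_hit_eq_sum_rook (hq : q ≠ 0) (x : K) {B : Finset (Square n)} (hB : IsFerrers B) :
    ∑ C ∈ placements (Finset.univ : Finset (Square n)) n, x ^ (C ∩ B).card * q ^ mat C B =
      ∑ k ∈ Finset.range (n + 1), (∏ i ∈ Finset.Icc 1 k, qNum q i) *
        (∑ C ∈ placements B (n - k), q ^ inv C B) * ∏ i ∈ Finset.Icc (k + 1) n, (x - q ^ i) := by
  classical
  -- The factor `q ^ n` per rook on `B` cancels the term `-n h` of `mat`.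
  obtain ⟨y, rfl⟩ : ∃ y, x = y * q ^ n := ⟨x / q ^ n, by field_simp⟩
  have hrook : ∀ k, ∑ C ∈ placements B k, q ^ inv C B =
      q ^ B.card * normRook q n (colCount B Finset.univ) k := by
    intro k
    have e := crossSum_rookCross hq hB n 0 k (zero_add n) Finset.univ
    rw [← card_region _ _ _ _ (zero_add n), crossSum, region_univ_zero] at e
    simpa [inv_eq_uncrossed] using e
  have hhit : ∑ C ∈ placements (Finset.univ : Finset (Square n)) n,
      (y * q ^ n) ^ (C ∩ B).card * q ^ mat C B =
      q ^ B.card * hitSum q y n (colCount B Finset.univ) := by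
    have e := crossSum_hitCross (q := q) y hB n 0 (zero_add n) Finset.univ (by simp)
    rw [crossSum, region_univ_zero] at e
    simp only [zero_add] at e
    rw [← e, Finset.mul_sum]
    refine Finset.sum_congr rfl fun C _ => ?_
    have hp : ∏ r ∈ C, (if r ∈ B then y else 1) = y ^ (C ∩ B).card := by
      rw [Finset.prod_ite_mem, Finset.prod_const]
    have hc := cross_add_uncrossed C B
    have hm : mat C B = (B.card : ℤ) + (uncrossed (HitCross B) C Finset.univ : ℤ) -
        (n : ℤ) * ((C ∩ B).card : ℤ) := by
      have hc' : (cross C B : ℤ) + (uncrossed (HitCross B) C Finset.univ : ℤ) = n * n := by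
        exact_mod_cast hc
      rw [mat]
      linear_combination -hc'
    rw [hp, hm, zpow_sub₀ hq, zpow_add₀ hq, mul_pow, ← pow_mul]
    have : q ^ ((n : ℤ) * ((C ∩ B).card : ℤ)) = q ^ (n * (C ∩ B).card) := by
      exact_mod_cast zpow_natCast q (n * (C ∩ B).card)
    rw [this, zpow_natCast, zpow_natCast]
    field_simp
  -- The sum is reversed because the generating polynomial is indexed by the number of rooks
  -- missing.
  rw [hhit, hitSum_eq_sum_normRook y hq n _ (colCount_mono hB _)
    (fun t => (colCount_le_card _ _ _).trans (by simp)),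
    ← Finset.sum_range_reflect _ (n + 1), Finset.mul_sum]
  refine Finset.sum_congr rfl fun k hk => ?_
  have hk' : k ≤ n := Nat.lt_succ_iff.1 (Finset.mem_range.1 hk)
  rw [show n + 1 - 1 - k = n - k by omega, hrook, hitCoeff_eq_prod y (Nat.sub_le n k),
    Nat.sub_sub_self hk']
  ring

/-- The field identity is applied with generic `q` and `x` in the fraction field of `ℤ[q, q⁻¹][x]`,
into which that ring embeds. -/
theorem map_hitGenPoly {B : Finset (Square n)} (hB : IsFerrers B) :
    (hitGenPoly B).map Polynomial.toLaurent =
      ∑ C ∈ placements (Finset.univ : Finset (Square n)) n,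
        Polynomial.X ^ (C ∩ B).card * Polynomial.C (LaurentPolynomial.T (mat C B)) := by
  let A := Polynomial (LaurentPolynomial ℤ)
  let F := FractionRing A
  have hinj : Function.Injective (algebraMap A F) := IsFractionRing.injective A F
  let ψ : LaurentPolynomial ℤ →+* F := (algebraMap A F).comp Polynomial.C
  let q : F := ψ (LaurentPolynomial.T 1)
  have hmul : ∀ a : ℤ, ψ (LaurentPolynomial.T a) * ψ (LaurentPolynomial.T (-a)) = 1 := by
    intro a
    rw [← map_mul, ← LaurentPolynomial.T_add, add_neg_cancel, LaurentPolynomial.T_zero, map_one]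
  have hq : q ≠ 0 := left_ne_zero_of_mul_eq_one (hmul 1)
  have hnat : ∀ a : ℕ, ψ (LaurentPolynomial.T (a : ℤ)) = q ^ a := by
    intro a
    rw [← map_pow, LaurentPolynomial.T_pow, mul_one]
  have hT : ∀ a : ℤ, ψ (LaurentPolynomial.T a) = q ^ a := by
    intro a
    obtain ⟨m, rfl | rfl⟩ := a.eq_nat_or_neg
    · rw [hnat, zpow_natCast]
    · rw [zpow_neg, zpow_natCast, ← hnat]
      exact eq_inv_of_mul_eq_one_right (hmul m)
  have hX : ψ (Polynomial.toLaurent Polynomial.X) = q := by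
    rw [Polynomial.toLaurent_X]
  have hqInt : ∀ k, ψ (Polynomial.toLaurent (qInt k)) = qNum q k := by
    intro k
    simp only [qInt, qNum, map_sum, map_pow, hX]
  have hC : ∀ a, algebraMap A F (Polynomial.C a) = ψ a := fun _ => rfl
  apply hinj
  have e := sum_hit_eq_sum_rook hq (algebraMap A F Polynomial.X) hB
  simp only [hitGenPoly, qFact, rookPoly, Polynomial.map_sum, Polynomial.map_mul,
    Polynomial.map_prod, Polynomial.map_sub, Polynomial.map_pow, Polynomial.map_C,
    Polynomial.map_X, map_sum, map_mul, map_prod, map_sub, map_pow]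
  simp only [hC, hX, hqInt, hT]
  exact e.symm

end Final

end QHit

/-- The identity is one of Laurent polynomials in `q` over `ℤ`, with `LaurentPolynomial.T m` the
monomial `q ^ m`; the left-hand side is the polynomial `T_k(B)` seen as a Laurent polynomial. -/
theorem theorem2 (n : ℕ) (B : Finset (QHit.Square n)) (hB : QHit.IsFerrers B) (k : ℕ) :
    Polynomial.toLaurent (QHit.hitPoly B k) =
      ∑ C ∈ QHit.hitPlacements B k, (LaurentPolynomial.T (QHit.mat C B) : LaurentPolynomial ℤ) := by
  classical
  have e := congrArg (fun p => p.coeff k) (QHit.map_hitGenPoly hB)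
  simp only [Polynomial.coeff_map, Polynomial.finsetSum_coeff, Polynomial.coeff_mul_C,
    Polynomial.coeff_X_pow, ite_mul, one_mul, zero_mul] at e
  rw [QHit.hitPoly, e, QHit.hitPlacements, Finset.sum_filter]
  refine Finset.sum_congr rfl fun C _ => ?_
  by_cases h : (C ∩ B).card = k
  · rw [if_pos h.symm, if_pos h]
  · rw [if_neg (Ne.symm h), if_neg h]
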